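/- Let $\sigma_1=\begin{bmatrix}0&1\\1&0\end{bmatrix}$, and let $\Psi$ be a $2\times2$ complex matrix-valued function on $\mathbb{C}\setminus[-1,1]$. Orient $[-1,1]$ from left to right and write $\Psi_+(t)$ and $\Psi_-(t)$ for the limits of $\Psi(z)$ as $z\to t$ from the upper, respectively lower, half-plane (unrestricted limits within the open half-plane). We say that $\Psi$ solves the model Riemann–Hilbert problem if all of the following hold: 1. $\Psi$ is analytic on $\overline{\mathbb{C}}\setminus[-1,1]$ (in particular at $\infty$, where it has a removable singularity); 2. the boundary values $\Psi_\pm(t)$ exist for all $t\in(-1,0)\cup(0,1)$, and $\Psi_+(t)=\Psi_-(t)\,(-i\sigma_1)$ for $t\in(-1,0)$, $\Psi_+(t)=\Psi_-(t)\,(i\sigma_1)$ for $t\in(0,1)$; 3. $\Psi(z)=O(|z-1|^{-1/4})$ as $z\to1$, $\Psi(z)=O(|z+1|^{-1/4})$ as $z\to-1$, and $\Psi(z)=O(|z|^{-1/2})$ as $z\to0$, where $z\in\mathbb{C}\setminus[-1,1]$ and the estimates are entrywise; 4. $\Psi(z)=\mathbf 1+O(z^{-1})$ as $z\to\infty$.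 Then $\Psi$ solves the model Riemann–Hilbert problem if and only if there exist $x,y\in\mathbb{C}$ such that, for all $z\in\mathbb{C}\setminus[-1,1]$, $$\Psi(z)=\left(\mathbf 1+\frac1z\begin{bmatrix}x&-x\\y&-y\end{bmatrix}\right)\left(\frac{z^2-1}{z^2}\right)^{\sigma_1/4},$$ where $w^{\sigma_1/4}=\exp\!\big(\tfrac14(\log w)\,\sigma_1\big)$ with the principal branch of the logarithm. -/

import Mathlib

open Filter Topology Asymptotics

noncomputable section

namespace ModelRHP

/-- The segment `[-1, 1]` of the real axis, as a subset of the complex plane. -/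
def cut : Set ℂ := (fun t : ℝ => (t : ℂ)) '' Set.Icc (-1) 1

/-- The first Pauli matrix. -/
def σ₁ : Matrix (Fin 2) (Fin 2) ℂ := !![0, 1; 1, 0]

/-- The scalar-to-matrix power `w ^ A = exp (log w • A)`, with the principal logarithm. -/
def matPow (w : ℂ) (A : Matrix (Fin 2) (Fin 2) ℂ) : Matrix (Fin 2) (Fin 2) ℂ :=
  NormedSpace.exp (Complex.log w • A)

/-- `Ψ` has a boundary value at the real point `t` from the upper half plane (the positive side of
the real axis, oriented from left to right) and one from the lower half plane, and they satisfy
`Ψ₊(t) = Ψ₋(t) J`. -/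
def HasJumpAt (Ψ : ℂ → Matrix (Fin 2) (Fin 2) ℂ) (t : ℝ) (J : Matrix (Fin 2) (Fin 2) ℂ) : Prop :=
  ∃ Ψp Ψm : Matrix (Fin 2) (Fin 2) ℂ,
    Tendsto Ψ (𝓝[{z : ℂ | 0 < z.im}] (t : ℂ)) (𝓝 Ψp) ∧
    Tendsto Ψ (𝓝[{z : ℂ | z.im < 0}] (t : ℂ)) (𝓝 Ψm) ∧
    Ψp = Ψm * J

/-- `Ψ` solves the model Riemann-Hilbert problem. The values of `Ψ` on `[-1, 1]` play no role. -/
structure IsSolution (Ψ : ℂ → Matrix (Fin 2) (Fin 2) ℂ) : Prop where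
  analytic : ∀ i j, AnalyticOnNhd ℂ (fun z => Ψ z i j) cutᶜ
  /-- Analyticity at `∞`, in the coordinate `w = 1 / z`. -/
  analytic_infty : ∀ i j, ∃ F : ℂ → ℂ, AnalyticAt ℂ F 0 ∧ ∀ᶠ w in 𝓝[≠] (0 : ℂ), Ψ w⁻¹ i j = F w
  jump_left : ∀ t ∈ Set.Ioo (-1 : ℝ) 0, HasJumpAt Ψ t (-Complex.I • σ₁)
  jump_right : ∀ t ∈ Set.Ioo (0 : ℝ) 1, HasJumpAt Ψ t (Complex.I • σ₁)
  growth_one : ∀ i j,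
    (fun z => Ψ z i j) =O[𝓝[cutᶜ] (1 : ℂ)] fun z => ‖z - 1‖ ^ (-(1 / 4) : ℝ)
  growth_neg_one : ∀ i j,
    (fun z => Ψ z i j) =O[𝓝[cutᶜ] (-1 : ℂ)] fun z => ‖z + 1‖ ^ (-(1 / 4) : ℝ)
  growth_zero : ∀ i j,
    (fun z => Ψ z i j) =O[𝓝[cutᶜ] (0 : ℂ)] fun z => ‖z‖ ^ (-(1 / 2) : ℝ)
  normalization : ∀ i j,
    (fun z => (Ψ z - 1) i j) =O[Bornology.cobounded ℂ] fun z => z⁻¹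

end ModelRHP

end

/-! The constant vectors (1, 1) and (1, -1) diagonalise `σ₁`, so the matrix problem splits into
scalar ones. In each row the sum s of the two entries jumps by the factor κ = ±i and the difference
d by -κ. The fourth root ρ of (z² - 1)/z² also jumps by κ, and 1/ρ jumps by 1/κ = -κ. Hence s/ρ and
dρ have no jump (`exists_tendsto_root`, `HasJumpAt.row`).

Such a function extends to an entire one once its isolated singularities are weaker than poles
(`exists_entire_eqOn`). For s/ρ the growth bounds give O(|z ∓ 1|^(-1/2)) at ±1 and O(1) at 0. Its
limit at infinity is 1, so Liouville gives s = ρ. For dρ the bound at 0 is only O(1/|z|), which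
permits a simple pole. Its residue, free in each row, is the source of the parameters x and y; the
rest is again constant by Liouville.

Conversely, 1/(zρ) is O(|z|^(-1/2)) at 0, exactly the growth allowed there, so every x and y is
admissible. -/

open Filter Topology Asymptotics

noncomputable section

namespace ModelRHP

/-! ### Removing the segment: Morera's theorem and division by zeros -/

/-- A continuous function on the plane that is holomorphic off the real axis is entire. -/
theorem differentiable_of_continuous_of_im_ne_zero {f : ℂ → ℂ} (hc : Continuous f)
    (hd : ∀ z : ℂ, z.im ≠ 0 → DifferentiableAt ℂ f z) : Differentiable ℂ f := by
  -- Cauchy's theorem for a rectangle whose interior misses the real axis; on the boundary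
  -- continuity suffices.
  have key : ∀ (a b p q : ℝ), (∀ y ∈ Set.Ioo (min p q) (max p q), y ≠ 0) →
      (∫ x : ℝ in a..b, f (x + p * Complex.I)) - (∫ x : ℝ in a..b, f (x + q * Complex.I)) +
      Complex.I • (∫ y : ℝ in p..q, f (b + y * Complex.I)) -
      Complex.I • (∫ y : ℝ in p..q, f (a + y * Complex.I)) = 0 := by
    intro a b p q h
    have := Complex.integral_boundary_rect_eq_zero_of_continuousOn_of_differentiableOn f
      (⟨a, p⟩ : ℂ) (⟨b, q⟩ : ℂ) hc.continuousOn
      (fun z hz => (hd z (h _ hz.2)).differentiableWithinAt)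
    simpa using this
  have hcons : Complex.IsConservativeOn f Set.univ := by
    intro z w _
    rw [← add_eq_zero_iff_eq_neg, Complex.wedgeIntegral_add_wedgeIntegral_eq]
    -- A rectangle may straddle the axis. Cut at height 0, it gives two pieces covered by `key`, and
    -- the integrals along the cut cancel.
    have h₁ := key z.re w.re z.im 0 (by
      rintro y ⟨h1, h2⟩ rfl
      rcases le_total z.im 0 with h | h <;> simp [h] at h1 h2)
    have h₂ := key z.re w.re 0 w.im (by
      rintro y ⟨h1, h2⟩ rfl
      rcases le_total w.im 0 with h | h <;> simp [h] at h1 h2)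
    have hI : ∀ (a p q : ℝ), IntervalIntegrable (fun y : ℝ => f (a + y * Complex.I))
        MeasureTheory.volume p q := fun a p q =>
      Continuous.intervalIntegrable (by fun_prop) _ _
    rw [← intervalIntegral.integral_add_adjacent_intervals (hI w.re z.im 0) (hI w.re 0 w.im),
      ← intervalIntegral.integral_add_adjacent_intervals (hI z.re z.im 0) (hI z.re 0 w.im)]
    simp only [smul_eq_mul] at h₁ h₂ ⊢
    linear_combination h₁ + h₂
  exact differentiableOn_univ.1
    ((Complex.isConservativeOn_and_continuousOn_iff_isDifferentiableOn isOpen_univ).1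
      ⟨hcons, hc.continuousOn⟩)

/-- An entire function vanishing at `p` is divisible by `z - p`. -/
theorem exists_entire_factor {G : ℂ → ℂ} (hG : Differentiable ℂ G) {p : ℂ} (hp : G p = 0) :
    ∃ H : ℂ → ℂ, Differentiable ℂ H ∧ ∀ z, G z = (z - p) * H z := by
  refine ⟨dslope G p, ?_, fun z => ?_⟩
  · rw [← differentiableOn_univ] at hG ⊢
    exact (Complex.differentiableOn_dslope univ_mem).2 hG
  · have := sub_smul_dslope G p z
    rw [hp, sub_zero, smul_eq_mul] at this
    exact this.symm

theorem mem_cut {z : ℂ} : z ∈ cut ↔ z.im = 0 ∧ -1 ≤ z.re ∧ z.re ≤ 1 := by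
  constructor
  · rintro ⟨t, ⟨h1, h2⟩, rfl⟩
    simp [h1, h2]
  · rintro ⟨h, h1, h2⟩
    exact ⟨z.re, ⟨h1, h2⟩, Complex.ext rfl (by simp [h])⟩

theorem isClosed_cut : IsClosed cut :=
  (isCompact_Icc.image Complex.continuous_ofReal).isClosed

theorem upper_subset : {z : ℂ | 0 < z.im} ⊆ cutᶜ := fun _ hz h => hz.ne' (mem_cut.1 h).1

theorem lower_subset : {z : ℂ | z.im < 0} ⊆ cutᶜ := fun _ hz h => hz.ne (mem_cut.1 h).1

theorem dense_compl_cut : Dense cutᶜ := by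
  intro z
  rcases le_total 0 z.im with h | h
  · refine closure_mono upper_subset ?_
    rw [Complex.closure_setOfPred_lt_im]
    exact h
  · refine closure_mono lower_subset ?_
    rw [Complex.closure_setOfPred_im_lt]
    exact h

/-- Near an interior point of the segment the slit plane is just the two open half-planes, so equal
one-sided limits give a limit off the cut. -/
theorem nhdsWithin_compl_cut_le {t : ℝ} (ht : t ∈ Set.Ioo (-1 : ℝ) 1) :
    𝓝[cutᶜ] (t : ℂ) ≤ 𝓝[{z : ℂ | 0 < z.im}] (t : ℂ) ⊔ 𝓝[{z : ℂ | z.im < 0}] (t : ℂ) := by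
  rw [← nhdsWithin_union]
  have hs : {z : ℂ | z.re ∈ Set.Ioo (-1 : ℝ) 1} ∈ 𝓝 (t : ℂ) :=
    (isOpen_Ioo.preimage Complex.continuous_re).mem_nhds (by simpa using ht)
  rw [← nhdsWithin_inter_of_mem' (nhdsWithin_le_nhds hs)]
  refine nhdsWithin_mono _ fun z ⟨hz, hz'⟩ => ?_
  rcases lt_trichotomy z.im 0 with h | h | h
  · exact Or.inr h
  · exact absurd (mem_cut.2 ⟨h, hz'.1.le, hz'.2.le⟩) hz
  · exact Or.inl h

/-- A function holomorphic off the segment, without jump on `(-1, 0) ∪ (0, 1)` and with weaker than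
polar singularities at `0` and `±1`, coincides with an entire function. -/
theorem exists_entire_eqOn {f : ℂ → ℂ} (hf : DifferentiableOn ℂ f cutᶜ)
    (hj : ∀ t ∈ Set.Ioo (-1 : ℝ) 1, t ≠ 0 → ∃ l : ℂ,
      Tendsto f (𝓝[{z : ℂ | 0 < z.im}] (t : ℂ)) (𝓝 l) ∧
      Tendsto f (𝓝[{z : ℂ | z.im < 0}] (t : ℂ)) (𝓝 l))
    (h0 : Tendsto (fun z => z * f z) (𝓝[cutᶜ] 0) (𝓝 0))
    (h1 : Tendsto (fun z => (z - 1) * f z) (𝓝[cutᶜ] 1) (𝓝 0))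
    (h2 : Tendsto (fun z => (z + 1) * f z) (𝓝[cutᶜ] (-1)) (𝓝 0)) :
    ∃ H : ℂ → ℂ, Differentiable ℂ H ∧ Set.EqOn f H cutᶜ := by
  -- The cubic factor turns the three singularities into zeros, so g extends continuously across the
  -- whole segment.
  set g : ℂ → ℂ := fun z => z * ((z - 1) * ((z + 1) * f z)) with hg
  have hid : ∀ {p : ℂ} {k : ℂ → ℂ}, Continuous k → Tendsto k (𝓝[cutᶜ] p) (𝓝 (k p)) :=
    fun hk => (hk.tendsto _).mono_left nhdsWithin_le_nhds
  have g0 : Tendsto g (𝓝[cutᶜ] 0) (𝓝 0) := by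
    have := (hid (p := 0) (k := fun z => (z - 1) * (z + 1)) (by fun_prop)).mul h0
    rw [mul_zero] at this
    exact this.congr fun z => by simp only [hg]; ring
  have g1 : Tendsto g (𝓝[cutᶜ] 1) (𝓝 0) := by
    have := (hid (p := 1) (k := fun z => z * (z + 1)) (by fun_prop)).mul h1
    rw [mul_zero] at this
    exact this.congr fun z => by simp only [hg]; ring
  have g2 : Tendsto g (𝓝[cutᶜ] (-1)) (𝓝 0) := by
    have := (hid (p := -1) (k := fun z => z * (z - 1)) (by fun_prop)).mul h2
    rw [mul_zero] at this
    exact this.congr fun z => by simp only [hg]; ring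
  have hgd : DifferentiableOn ℂ g cutᶜ := by
    simp only [hg]
    fun_prop
  have hlim : ∀ x ∈ (Set.univ : Set ℂ), ∃ y, Tendsto g (𝓝[cutᶜ] x) (𝓝 y) := by
    intro x _
    by_cases hx : x ∈ cut
    · obtain ⟨t, ⟨ht1, ht2⟩, rfl⟩ := hx
      rcases eq_or_ne t 0 with rfl | h
      · exact ⟨0, by simpa using g0⟩
      rcases eq_or_ne t 1 with rfl | h'
      · exact ⟨0, by simpa using g1⟩
      rcases eq_or_ne t (-1) with rfl | h''
      · exact ⟨0, by simpa using g2⟩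
      have ht : t ∈ Set.Ioo (-1 : ℝ) 1 := ⟨lt_of_le_of_ne ht1 h''.symm, lt_of_le_of_ne ht2 h'⟩
      obtain ⟨l, hl1, hl2⟩ := hj t ht h
      have hl := (hl1.sup hl2).mono_left (nhdsWithin_compl_cut_le ht)
      exact ⟨_, (hid continuous_id).mul ((hid (k := fun z => z - 1) (by fun_prop)).mul
        ((hid (k := fun z => z + 1) (by fun_prop)).mul hl))⟩
    · exact ⟨g x, hgd.continuousOn x hx⟩
  set G := extendFrom cutᶜ g with hGdef
  have hGc : Continuous G := by
    rw [← continuousOn_univ]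
    exact continuousOn_extendFrom (fun x _ => dense_compl_cut x) hlim
  have hGg : Set.EqOn G g cutᶜ := extendFrom_extends hgd.continuousOn
  have hGd : Differentiable ℂ G := by
    refine differentiable_of_continuous_of_im_ne_zero hGc fun z hz => ?_
    have hz' : cutᶜ ∈ 𝓝 z := isClosed_cut.isOpen_compl.mem_nhds fun h => hz (mem_cut.1 h).1
    exact (hgd.differentiableAt hz').congr_of_eventuallyEq (hGg.eventuallyEq_of_mem hz')
  have G0 : G 0 = 0 := extendFrom_eq (dense_compl_cut _) g0
  have G1 : G 1 = 0 := extendFrom_eq (dense_compl_cut _) g1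
  have G2 : G (-1) = 0 := extendFrom_eq (dense_compl_cut _) g2
  -- The zeros at 0, 1 and -1 are divided out again, undoing the cubic factor.
  obtain ⟨A, hA, hA'⟩ := exists_entire_factor hGd G0
  obtain ⟨B, hB, hB'⟩ := exists_entire_factor hA (p := 1) (by
    have := hA' 1
    rw [G1] at this
    simpa using this.symm)
  obtain ⟨H, hH, hH'⟩ := exists_entire_factor hB (p := -1) (by
    have := hA' (-1)
    rw [G2, hB'] at this
    norm_num at this
    exact this)
  refine ⟨H, hH, fun z hz => ?_⟩
  have e := hGg hz
  rw [hA', hB', hH'] at e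
  have n0 : z ≠ 0 := by rintro rfl; exact hz (mem_cut.2 (by simp))
  have n1 : z - 1 ≠ 0 := fun h => hz (mem_cut.2 (by simp [sub_eq_zero.1 h]))
  have n2 : z + 1 ≠ 0 := fun h => hz (mem_cut.2 (by simp [eq_neg_of_add_eq_zero_left h]))
  simp only [hg, sub_zero, sub_neg_eq_add] at e
  exact (mul_left_cancel₀ n2 (mul_left_cancel₀ n1 (mul_left_cancel₀ n0 e))).symm

/-! ### The scalar fourth root and its growth at 0 and ±1 -/

/-- The rational function `(z² - 1) / z²`. -/
def ratio (z : ℂ) : ℂ := (z ^ 2 - 1) / z ^ 2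

/-- The principal fourth root of `(z² - 1) / z²`. -/
def root (z : ℂ) : ℂ := Complex.exp (Complex.log (ratio z) / 4)

theorem root_ne_zero (z : ℂ) : root z ≠ 0 := Complex.exp_ne_zero _

theorem ne_zero_of_mem_compl_cut {z : ℂ} (hz : z ∈ cutᶜ) : z ≠ 0 := by
  rintro rfl
  exact hz (mem_cut.2 (by simp))

/-- If the ratio were a real r ≤ 0, then z² = 1/(1 - r) would lie in (0, 1], forcing z into the
segment. -/
theorem ratio_mem_slitPlane {z : ℂ} (hz : z ∈ cutᶜ) : ratio z ∈ Complex.slitPlane := by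
  have hz0 := ne_zero_of_mem_compl_cut hz
  by_contra h
  rw [Complex.mem_slitPlane_iff, not_or, not_lt, not_not] at h
  obtain ⟨hr, hi⟩ := h
  set r := (ratio z).re with hrdef
  have e : z ^ 2 - 1 = r * z ^ 2 := by
    have : ratio z = r := Complex.ext rfl (by simp [hi])
    rw [← this, ratio, div_mul_cancel₀ _ (pow_ne_zero _ hz0)]
  have e1 := congrArg Complex.re e
  have e2 := congrArg Complex.im e
  simp [pow_two] at e1 e2
  apply hz
  have h3 : z.re * z.im = 0 := by
    have : (1 - r) * (z.re * z.im) = 0 := by linear_combination e2 / 2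
    rcases mul_eq_zero.1 this with h | h
    · linarith
    · exact h
  have him : z.im = 0 := by
    rcases mul_eq_zero.1 h3 with h | h
    · rw [h] at e1
      nlinarith [mul_self_nonneg z.im]
    · exact h
  rw [him] at e1
  have : z.re ^ 2 ≤ 1 := by nlinarith [sq_nonneg z.re]
  exact mem_cut.2 ⟨him, abs_le.1 ((sq_le_one_iff_abs_le_one _).1 this)⟩

theorem analyticOnNhd_root : AnalyticOnNhd ℂ root cutᶜ := by
  intro z hz
  have h : AnalyticAt ℂ ratio z := by
    unfold ratio
    exact ((analyticAt_id.pow 2).sub analyticAt_const).div (analyticAt_id.pow 2)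
      (pow_ne_zero _ (ne_zero_of_mem_compl_cut hz))
  exact ((h.clog (ratio_mem_slitPlane hz)).div analyticAt_const (by norm_num)).cexp

theorem norm_root {z : ℂ} (hz : z ∈ cutᶜ) : ‖root z‖ = ‖ratio z‖ ^ (1 / 4 : ℝ) := by
  have h : 0 < ‖ratio z‖ := norm_pos_iff.2 (Complex.slitPlane_ne_zero (ratio_mem_slitPlane hz))
  rw [root, Complex.norm_exp, Real.rpow_def_of_pos h, ← Complex.log_re]
  simp [div_eq_mul_inv]

theorem norm_root_inv {z : ℂ} (hz : z ∈ cutᶜ) :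
    ‖(root z)⁻¹‖ = ‖ratio z‖ ^ (-(1 / 4) : ℝ) := by
  rw [norm_inv, norm_root hz, Real.rpow_neg (norm_nonneg _)]

theorem norm_ratio (z : ℂ) : ‖ratio z‖ = ‖z - 1‖ * (‖z + 1‖ / ‖z‖ ^ 2) := by
  rw [ratio, show z ^ 2 - 1 = (z - 1) * (z + 1) by ring, norm_div, norm_mul, norm_pow, mul_div_assoc]

/-- If `‖ratio z‖ = u z * v z` with `v` tending to a positive number, then any power of
`‖ratio z‖` is controlled by the same power of `u`. -/
theorem isBigO_rpow_norm_ratio {l : Filter ℂ} {u v : ℂ → ℝ} {b : ℝ}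
    (he : ∀ᶠ z in l, ‖ratio z‖ = u z * v z) (hu : ∀ z, 0 ≤ u z) (hv : ∀ z, 0 ≤ v z)
    (hb : b ≠ 0) (hl : Tendsto v l (𝓝 b)) (c : ℝ) :
    (fun z => ‖ratio z‖ ^ c) =O[l] fun z => u z ^ c := by
  have h1 : (fun z => v z ^ c) =O[l] fun _ => (1 : ℝ) :=
    (hl.rpow_const (Or.inl hb)).isBigO_one ℝ
  have h2 : (fun z => u z ^ c * v z ^ c) =O[l] fun z => u z ^ c * 1 := (isBigO_refl _ _).mul h1
  simp only [mul_one] at h2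
  refine h2.congr' (he.mono fun z hz => ?_) EventuallyEq.rfl
  simp only [hz, Real.mul_rpow (hu z) (hv z)]

theorem isBigO_norm_ratio_one (c : ℝ) :
    (fun z => ‖ratio z‖ ^ c) =O[𝓝[cutᶜ] (1 : ℂ)] fun z => ‖z - 1‖ ^ c := by
  refine isBigO_rpow_norm_ratio (v := fun z => ‖z + 1‖ / ‖z‖ ^ 2) (b := ‖(1 : ℂ) + 1‖ / ‖(1 : ℂ)‖ ^ 2)
    (Eventually.of_forall norm_ratio) (fun _ => norm_nonneg _) (fun _ => by positivity)
    (by norm_num) ?_ c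
  refine Tendsto.mono_left ?_ nhdsWithin_le_nhds
  exact ContinuousAt.tendsto (by fun_prop (disch := norm_num))

theorem isBigO_norm_ratio_neg_one (c : ℝ) :
    (fun z => ‖ratio z‖ ^ c) =O[𝓝[cutᶜ] (-1 : ℂ)] fun z => ‖z + 1‖ ^ c := by
  refine isBigO_rpow_norm_ratio (v := fun z => ‖z - 1‖ / ‖z‖ ^ 2)
    (b := ‖(-1 : ℂ) - 1‖ / ‖(-1 : ℂ)‖ ^ 2)
    (Eventually.of_forall fun z => by rw [norm_ratio]; ring) (fun _ => norm_nonneg _)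
    (fun _ => by positivity) (by norm_num) ?_ c
  refine Tendsto.mono_left ?_ nhdsWithin_le_nhds
  exact ContinuousAt.tendsto (by fun_prop (disch := norm_num))

theorem isBigO_norm_ratio_zero (c : ℝ) :
    (fun z => ‖ratio z‖ ^ c) =O[𝓝[cutᶜ] (0 : ℂ)] fun z => ‖z‖ ^ (-2 * c) := by
  have h := isBigO_rpow_norm_ratio (l := 𝓝[cutᶜ] (0 : ℂ)) (u := fun z => ‖z‖ ^ (-2 : ℝ))
    (v := fun z => ‖z - 1‖ * ‖z + 1‖) (b := ‖(0 : ℂ) - 1‖ * ‖(0 : ℂ) + 1‖)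
    (Eventually.of_forall fun z => by
      rw [norm_ratio, Real.rpow_neg (norm_nonneg _), Real.rpow_two]; ring)
    (fun _ => by positivity) (fun _ => by positivity) (by norm_num) (by
      refine Tendsto.mono_left ?_ nhdsWithin_le_nhds
      exact ContinuousAt.tendsto (by fun_prop)) c
  simpa only [← Real.rpow_mul (norm_nonneg _)] using h

theorem isBigO_of_norm_eq_rpow {f : ℂ → ℂ} {p : ℂ} {c : ℝ} {g : ℂ → ℝ}
    (hf : ∀ z ∈ cutᶜ, ‖f z‖ = ‖ratio z‖ ^ c)
    (h : (fun z => ‖ratio z‖ ^ c) =O[𝓝[cutᶜ] p] g) : f =O[𝓝[cutᶜ] p] g := by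
  rw [← isBigO_norm_left]
  exact h.congr' (eventually_mem_nhdsWithin.mono fun z hz => (hf z hz).symm) EventuallyEq.rfl

theorem root_isBigO_one :
    root =O[𝓝[cutᶜ] (1 : ℂ)] fun z => ‖z - 1‖ ^ (1 / 4 : ℝ) :=
  isBigO_of_norm_eq_rpow (fun _ => norm_root) (isBigO_norm_ratio_one _)

theorem root_inv_isBigO_one :
    (fun z => (root z)⁻¹) =O[𝓝[cutᶜ] (1 : ℂ)] fun z => ‖z - 1‖ ^ (-(1 / 4) : ℝ) :=
  isBigO_of_norm_eq_rpow (fun _ => norm_root_inv) (isBigO_norm_ratio_one _)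

theorem root_isBigO_neg_one :
    root =O[𝓝[cutᶜ] (-1 : ℂ)] fun z => ‖z + 1‖ ^ (1 / 4 : ℝ) :=
  isBigO_of_norm_eq_rpow (fun _ => norm_root) (isBigO_norm_ratio_neg_one _)

theorem root_inv_isBigO_neg_one :
    (fun z => (root z)⁻¹) =O[𝓝[cutᶜ] (-1 : ℂ)] fun z => ‖z + 1‖ ^ (-(1 / 4) : ℝ) :=
  isBigO_of_norm_eq_rpow (fun _ => norm_root_inv) (isBigO_norm_ratio_neg_one _)

theorem root_isBigO_zero :
    root =O[𝓝[cutᶜ] (0 : ℂ)] fun z => ‖z‖ ^ (-(1 / 2) : ℝ) := by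
  refine isBigO_of_norm_eq_rpow (fun _ => norm_root) ?_
  convert isBigO_norm_ratio_zero (1 / 4) using 3
  norm_num

theorem root_inv_isBigO_zero :
    (fun z => (root z)⁻¹) =O[𝓝[cutᶜ] (0 : ℂ)] fun z => ‖z‖ ^ (1 / 2 : ℝ) := by
  refine isBigO_of_norm_eq_rpow (fun _ => norm_root_inv) ?_
  convert isBigO_norm_ratio_zero (-(1 / 4)) using 3
  norm_num

/-- Near a point, larger powers of the distance are dominated by smaller ones. -/
theorem isBigO_rpow_norm_sub {p : ℂ} (hp : p ∈ cut) {a b : ℝ} (hab : a ≤ b) :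
    (fun z => ‖z - p‖ ^ b) =O[𝓝[cutᶜ] p] fun z => ‖z - p‖ ^ a := by
  refine IsBigO.of_bound' ?_
  filter_upwards [eventually_mem_nhdsWithin, nhdsWithin_le_nhds (Metric.ball_mem_nhds p one_pos)]
    with z h1 h2
  have hz : z ≠ p := fun h => h1 (h ▸ hp)
  rw [Real.norm_of_nonneg (by positivity), Real.norm_of_nonneg (by positivity)]
  exact Real.rpow_le_rpow_of_exponent_ge (norm_pos_iff.2 (sub_ne_zero.2 hz))
    (by simpa [dist_eq_norm] using (Metric.mem_ball.1 h2).le) hab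

/-! ### The fourth root at infinity -/

theorem ratio_inv {w : ℂ} (hw : w ≠ 0) : ratio w⁻¹ = 1 - w ^ 2 := by
  rw [ratio]
  field_simp

/-- The function `root` in the coordinate `w = 1 / z`. -/
theorem analyticAt_root_infty :
    AnalyticAt ℂ (fun w : ℂ => Complex.exp (Complex.log (1 - w ^ 2) / 4)) 0 := by
  refine AnalyticAt.cexp (AnalyticAt.div (AnalyticAt.clog ?_ ?_) analyticAt_const (by norm_num))
  · exact analyticAt_const.sub (analyticAt_id.pow 2)
  · simp

theorem root_inv_eq {w : ℂ} (hw : w ≠ 0) :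
    root w⁻¹ = Complex.exp (Complex.log (1 - w ^ 2) / 4) := by
  rw [root, ratio_inv hw]

theorem tendsto_root_cobounded : Tendsto root (Bornology.cobounded ℂ) (𝓝 1) := by
  have h1 : Tendsto (fun z : ℂ => z⁻¹) (Bornology.cobounded ℂ) (𝓝 0) := tendsto_inv₀_cobounded
  have h2 := analyticAt_root_infty.continuousAt.tendsto.comp h1
  simp only [ne_eq, OfNat.ofNat_ne_zero, not_false_eq_true, zero_pow, sub_zero, Complex.log_one,
    zero_div, Complex.exp_zero] at h2
  refine h2.congr' ?_
  filter_upwards [Bornology.eventually_ne_cobounded (0 : ℂ)] with z hz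
  have := root_inv_eq (inv_ne_zero hz)
  rw [inv_inv] at this
  exact this.symm

/-! ### Boundary values of the fourth root -/

/-- The sign of the jump: `i` on the right half of the segment and `-i` on the left half. -/
def jumpFactor (t : ℝ) : ℂ := if 0 < t then Complex.I else -Complex.I

theorem jumpFactor_mul_self (t : ℝ) : jumpFactor t * jumpFactor t = -1 := by
  unfold jumpFactor
  split_ifs <;> simp

theorem im_ratio (z : ℂ) : (ratio z).im = 2 * (z.re * z.im) / Complex.normSq (z ^ 2) := by
  rw [ratio, Complex.div_im]
  simp [pow_two]
  ring

theorem ratio_ofReal (t : ℝ) : ratio t = ((t ^ 2 - 1) / t ^ 2 : ℝ) := by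
  simp [ratio]

theorem continuousAt_ratio {z : ℂ} (hz : z ≠ 0) : ContinuousAt ratio z := by
  unfold ratio
  fun_prop (disch := simpa)

/-- On the segment the ratio is negative, hence on the branch cut of the logarithm. The sign of Re z
· Im z decides from which side that cut is approached, and so the argument ±π in the limit. -/
theorem tendsto_root_of_re_mul_im_pos {t : ℝ} (ht : t ∈ Set.Ioo (-1 : ℝ) 1) (h0 : t ≠ 0)
    {S : Set ℂ} (hS : ∀ᶠ z in 𝓝[S] (t : ℂ), 0 < z.re * z.im) :
    Tendsto root (𝓝[S] (t : ℂ))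
      (𝓝 (Complex.exp ((Real.log ‖ratio t‖ + Real.pi * Complex.I) / 4))) := by
  have hc : Tendsto ratio (𝓝[S] (t : ℂ)) (𝓝[{z : ℂ | 0 ≤ z.im}] (ratio t)) := by
    refine tendsto_nhdsWithin_iff.2 ⟨(continuousAt_ratio (by simpa)).mono_left
      nhdsWithin_le_nhds, hS.mono fun z hz => ?_⟩
    rw [Set.mem_ofPred_eq, im_ratio]
    exact div_nonneg (by linarith) (Complex.normSq_nonneg _)
  have hneg : (ratio t).re < 0 := by
    rw [ratio_ofReal, Complex.ofReal_re]
    exact div_neg_of_neg_of_pos (by nlinarith [ht.1, ht.2]) (by positivity)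
  have := (Complex.tendsto_log_nhdsWithin_im_nonneg_of_re_neg_of_im_zero hneg
    (by rw [ratio_ofReal, Complex.ofReal_im])).comp hc
  exact (Complex.continuous_exp.tendsto _).comp (this.div_const 4)

theorem tendsto_root_of_re_mul_im_neg {t : ℝ} (ht : t ∈ Set.Ioo (-1 : ℝ) 1) (h0 : t ≠ 0)
    {S : Set ℂ} (hS : ∀ᶠ z in 𝓝[S] (t : ℂ), z.re * z.im < 0) :
    Tendsto root (𝓝[S] (t : ℂ))
      (𝓝 (Complex.exp ((Real.log ‖ratio t‖ - Real.pi * Complex.I) / 4))) := by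
  -- The inequality must be strict here: on the negative axis itself the principal argument is +π.
  have hc : Tendsto ratio (𝓝[S] (t : ℂ)) (𝓝[{z : ℂ | z.im < 0}] (ratio t)) := by
    refine tendsto_nhdsWithin_iff.2 ⟨(continuousAt_ratio (by simpa)).mono_left
      nhdsWithin_le_nhds, hS.mono fun z hz => ?_⟩
    rw [Set.mem_ofPred_eq, im_ratio]
    have hz0 : z ≠ 0 := by
      rintro rfl
      simp at hz
    exact div_neg_of_neg_of_pos (by linarith) (Complex.normSq_pos.2 (pow_ne_zero _ hz0))
  have hneg : (ratio t).re < 0 := by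
    rw [ratio_ofReal, Complex.ofReal_re]
    exact div_neg_of_neg_of_pos (by nlinarith [ht.1, ht.2]) (by positivity)
  have := (Complex.tendsto_log_nhdsWithin_im_neg_of_re_neg_of_im_zero hneg
    (by rw [ratio_ofReal, Complex.ofReal_im])).comp hc
  exact (Complex.continuous_exp.tendsto _).comp (this.div_const 4)

theorem exp_add_pi_div_four (a : ℂ) :
    Complex.exp ((a + Real.pi * Complex.I) / 4) =
      Complex.I * Complex.exp ((a - Real.pi * Complex.I) / 4) := by
  nth_rw 2 [← Complex.exp_pi_div_two_mul_I]
  rw [← Complex.exp_add]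
  congr 1
  ring

/-- The function `root` has boundary values on `(-1, 0) ∪ (0, 1)`, and their quotient is `±i`. -/
theorem exists_tendsto_root {t : ℝ} (ht : t ∈ Set.Ioo (-1 : ℝ) 1) (h0 : t ≠ 0) :
    ∃ r : ℂ, r ≠ 0 ∧ Tendsto root (𝓝[{z : ℂ | 0 < z.im}] (t : ℂ)) (𝓝 (jumpFactor t * r)) ∧
      Tendsto root (𝓝[{z : ℂ | z.im < 0}] (t : ℂ)) (𝓝 r) := by
  have hre : Tendsto Complex.re (𝓝 (t : ℂ)) (𝓝 t) := Complex.continuous_re.tendsto (t : ℂ)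
  rcases h0.lt_or_gt with h | h
  · have hre' : ∀ S : Set ℂ, ∀ᶠ z in 𝓝[S] (t : ℂ), z.re < 0 := fun S =>
      nhdsWithin_le_nhds (hre.eventually_lt_const h)
    -- For Re z < 0 the ratio has imaginary part opposite in sign to that of z, which turns the jump
    -- i into -i.
    refine ⟨_, Complex.exp_ne_zero _, ?_, tendsto_root_of_re_mul_im_pos ht h0 ?_⟩
    · rw [exp_add_pi_div_four, jumpFactor, if_neg h.not_gt, ← mul_assoc, neg_mul, Complex.I_mul_I,
        neg_neg, one_mul]
      refine tendsto_root_of_re_mul_im_neg ht h0 ?_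
      filter_upwards [hre' _, eventually_mem_nhdsWithin] with z h1 h2
      exact mul_neg_of_neg_of_pos h1 h2
    · filter_upwards [hre' _, eventually_mem_nhdsWithin] with z h1 h2
      exact mul_pos_of_neg_of_neg h1 h2
  · have hre' : ∀ S : Set ℂ, ∀ᶠ z in 𝓝[S] (t : ℂ), 0 < z.re := fun S =>
      nhdsWithin_le_nhds (hre.eventually_const_lt h)
    refine ⟨_, Complex.exp_ne_zero _, ?_, tendsto_root_of_re_mul_im_neg ht h0 ?_⟩
    · rw [jumpFactor, if_pos h, ← exp_add_pi_div_four]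
      refine tendsto_root_of_re_mul_im_pos ht h0 ?_
      filter_upwards [hre' _, eventually_mem_nhdsWithin] with z h1 h2
      exact mul_pos h1 h2
    · filter_upwards [hre' _, eventually_mem_nhdsWithin] with z h1 h2
      exact mul_neg_of_pos_of_neg h1 h2

/-! ### Diagonalising `σ₁`; the explicit formula by rows -/

theorem exp_smul_σ₁ (a : ℂ) : NormedSpace.exp (a • σ₁) =
    !![(Complex.exp a + Complex.exp (-a)) / 2, (Complex.exp a - Complex.exp (-a)) / 2;
       (Complex.exp a - Complex.exp (-a)) / 2, (Complex.exp a + Complex.exp (-a)) / 2] := by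
  have hU : (!![1, 1; 1, -1] : Matrix (Fin 2) (Fin 2) ℂ) * !![1 / 2, 1 / 2; 1 / 2, -1 / 2] = 1 := by
    ext i j
    fin_cases i <;> fin_cases j <;> simp [Matrix.mul_apply, Fin.sum_univ_two] <;> norm_num
  have hinv := Matrix.inv_eq_right_inv hU
  have hunit : IsUnit (!![1, 1; 1, -1] : Matrix (Fin 2) (Fin 2) ℂ) :=
    IsUnit.of_mul_eq_one _ hU
  -- The columns (1, 1) and (1, -1) are eigenvectors of `σ₁` for the eigenvalues 1 and -1.
  have e : a • σ₁ = !![1, 1; 1, -1] * Matrix.diagonal ![a, -a] * (!![1, 1; 1, -1])⁻¹ := by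
    rw [hinv]
    ext i j
    fin_cases i <;> fin_cases j <;> simp [σ₁, Matrix.mul_apply, Fin.sum_univ_two, Matrix.vecMul_diagonal] <;> ring
  rw [e, Matrix.exp_conj _ _ hunit, Matrix.exp_diagonal, hinv]
  ext i j
  fin_cases i <;> fin_cases j <;>
    simp [Matrix.mul_apply, Fin.sum_univ_two, Matrix.vecMul_diagonal, Pi.coe_exp, ← Complex.exp_eq_exp_ℂ] <;> ring

theorem matPow_eq (z : ℂ) : matPow ((z ^ 2 - 1) / z ^ 2) ((1 / 4 : ℂ) • σ₁) =
    !![(root z + (root z)⁻¹) / 2, (root z - (root z)⁻¹) / 2;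
       (root z - (root z)⁻¹) / 2, (root z + (root z)⁻¹) / 2] := by
  rw [matPow, smul_smul, exp_smul_σ₁, Complex.exp_neg, mul_one_div]
  rfl

/-- The signs `1, -1`. -/
def sgn : Fin 2 → ℂ := ![1, -1]

/-- The explicit formula, expressed by sums and differences of the entries in each row. -/
theorem eq_formula_iff (A : Matrix (Fin 2) (Fin 2) ℂ) (ξ : Fin 2 → ℂ) (z : ℂ) :
    A = (1 + (1 / z) • !![ξ 0, -ξ 0; ξ 1, -ξ 1]) *
        matPow ((z ^ 2 - 1) / z ^ 2) ((1 / 4 : ℂ) • σ₁) ↔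
      ∀ i, A i 0 + A i 1 = root z ∧
        A i 0 - A i 1 = (sgn i + 2 * ξ i / z) * (root z)⁻¹ := by
  rw [matPow_eq, ← Matrix.ext_iff]
  simp only [Fin.forall_fin_two, Matrix.mul_apply, Fin.sum_univ_two]
  simp [sgn]
  constructor
  · rintro ⟨⟨h1, h2⟩, h3, h4⟩
    rw [h1, h2, h3, h4]
    refine ⟨⟨?_, ?_⟩, ?_, ?_⟩ <;> ring
  · rintro ⟨⟨h1, h2⟩, h3, h4⟩
    refine ⟨⟨?_, ?_⟩, ?_, ?_⟩
    · linear_combination (h1 + h2) / 2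
    · linear_combination (h1 - h2) / 2
    · linear_combination (h3 + h4) / 2
    · linear_combination (h3 - h4) / 2

/-! ### Scalar jumps, growth of products, Liouville's theorem -/

theorem jumpFactor_ne_zero (t : ℝ) : jumpFactor t ≠ 0 := by
  intro h
  simpa [h] using jumpFactor_mul_self t

theorem IsSolution.hasJumpAt {Ψ : ℂ → Matrix (Fin 2) (Fin 2) ℂ} (h : IsSolution Ψ) {t : ℝ}
    (ht : t ∈ Set.Ioo (-1 : ℝ) 1) (h0 : t ≠ 0) : HasJumpAt Ψ t (jumpFactor t • σ₁) := by
  unfold jumpFactor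
  split_ifs with hpos
  · exact h.jump_right t ⟨hpos, ht.2⟩
  · exact h.jump_left t ⟨ht.1, lt_of_le_of_ne (not_lt.1 hpos) h0⟩

/-- In each row, the sum and the difference of the entries have scalar jumps. -/
theorem HasJumpAt.row {Ψ : ℂ → Matrix (Fin 2) (Fin 2) ℂ} {t : ℝ} {κ : ℂ}
    (h : HasJumpAt Ψ t (κ • σ₁)) (i : Fin 2) : ∃ s d : ℂ,
      Tendsto (fun z => Ψ z i 0 + Ψ z i 1) (𝓝[{z : ℂ | 0 < z.im}] (t : ℂ)) (𝓝 (κ * s)) ∧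
      Tendsto (fun z => Ψ z i 0 + Ψ z i 1) (𝓝[{z : ℂ | z.im < 0}] (t : ℂ)) (𝓝 s) ∧
      Tendsto (fun z => Ψ z i 0 - Ψ z i 1) (𝓝[{z : ℂ | 0 < z.im}] (t : ℂ)) (𝓝 (-(κ * d))) ∧
      Tendsto (fun z => Ψ z i 0 - Ψ z i 1) (𝓝[{z : ℂ | z.im < 0}] (t : ℂ)) (𝓝 d) := by
  obtain ⟨P, M, hP, hM, e⟩ := h
  have hP' : ∀ j, Tendsto (fun z => Ψ z i j) _ (𝓝 (P i j)) := fun j =>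
    tendsto_pi_nhds.1 (tendsto_pi_nhds.1 hP i) j
  have hM' : ∀ j, Tendsto (fun z => Ψ z i j) _ (𝓝 (M i j)) := fun j =>
    tendsto_pi_nhds.1 (tendsto_pi_nhds.1 hM i) j
  have e0 : P i 0 = κ * M i 1 := by
    rw [e]; simp [Matrix.mul_apply, Fin.sum_univ_two, σ₁, mul_comm]
  have e1 : P i 1 = κ * M i 0 := by
    rw [e]; simp [Matrix.mul_apply, Fin.sum_univ_two, σ₁, mul_comm]
  refine ⟨M i 0 + M i 1, M i 0 - M i 1, ?_, (hM' 0).add (hM' 1), ?_, (hM' 0).sub (hM' 1)⟩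
  · convert (hP' 0).add (hP' 1) using 2
    rw [e0, e1]; ring
  · convert (hP' 0).sub (hP' 1) using 2
    rw [e0, e1]; ring

/-- A product of two functions with power bounds at `p`, of total order above `-1`, is killed by
the factor `z - p`. -/
theorem tendsto_sub_mul_of_isBigO {F G : ℂ → ℂ} {p : ℂ} (hp : p ∈ cut) {a b : ℝ}
    (hab : -1 < a + b) (hF : F =O[𝓝[cutᶜ] p] fun z => ‖z - p‖ ^ a)
    (hG : G =O[𝓝[cutᶜ] p] fun z => ‖z - p‖ ^ b) :
    Tendsto (fun z => (z - p) * (F z * G z)) (𝓝[cutᶜ] p) (𝓝 0) := by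
  have h1 : (fun z : ℂ => z - p) =O[𝓝[cutᶜ] p] fun z => ‖z - p‖ ^ (1 : ℝ) := by
    simp only [Real.rpow_one]
    exact (isBigO_refl _ _).norm_right
  refine (h1.mul (hF.mul hG)).trans_tendsto ?_
  have h2 : Tendsto (fun z : ℂ => ‖z - p‖ ^ (1 + (a + b))) (𝓝[cutᶜ] p) (𝓝 0) := by
    have h3 : Tendsto (fun z : ℂ => ‖z - p‖) (𝓝[cutᶜ] p) (𝓝 0) := by
      refine Tendsto.mono_left ?_ nhdsWithin_le_nhds
      have : Continuous fun z : ℂ => ‖z - p‖ := by fun_prop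
      simpa using this.tendsto p
    have := h3.rpow_const (p := 1 + (a + b)) (Or.inr (by linarith))
    rwa [Real.zero_rpow (by linarith)] at this
  refine h2.congr' (eventually_mem_nhdsWithin.mono fun z hz => ?_)
  have hz' : 0 < ‖z - p‖ := norm_pos_iff.2 (sub_ne_zero.2 fun h => hz (h ▸ hp))
  simp only [Real.rpow_add hz']

theorem zero_mem_cut : (0 : ℂ) ∈ cut := mem_cut.2 (by simp)

theorem one_mem_cut : (1 : ℂ) ∈ cut := mem_cut.2 (by simp)

theorem neg_one_mem_cut : (-1 : ℂ) ∈ cut := mem_cut.2 (by simp)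

theorem compl_cut_mem_cobounded : cutᶜ ∈ Bornology.cobounded ℂ :=
  (isCompact_Icc.image Complex.continuous_ofReal).isBounded

theorem eq_of_tendsto_cobounded {H : ℂ → ℂ} (hH : Differentiable ℂ H) {c : ℂ}
    (h : Tendsto H (Bornology.cobounded ℂ) (𝓝 c)) (z : ℂ) : H z = c :=
  hH.apply_eq_of_tendsto_cocompact z (by rwa [← Metric.cobounded_eq_cocompact])

/-! ### Every solution has the stated form -/

namespace IsSolution

variable {Ψ : ℂ → Matrix (Fin 2) (Fin 2) ℂ}

theorem tendsto_cobounded (h : IsSolution Ψ) (i j : Fin 2) :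
    Tendsto (fun z => Ψ z i j) (Bornology.cobounded ℂ) (𝓝 ((1 : Matrix (Fin 2) (Fin 2) ℂ) i j)) := by
  have := (h.normalization i j).trans_tendsto tendsto_inv₀_cobounded
  simpa using this.add_const ((1 : Matrix (Fin 2) (Fin 2) ℂ) i j)

theorem tendsto_add_cobounded (h : IsSolution Ψ) (i : Fin 2) :
    Tendsto (fun z => Ψ z i 0 + Ψ z i 1) (Bornology.cobounded ℂ) (𝓝 1) := by
  convert (h.tendsto_cobounded i 0).add (h.tendsto_cobounded i 1) using 2
  fin_cases i <;> simp [Matrix.one_apply]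

theorem tendsto_sub_cobounded (h : IsSolution Ψ) (i : Fin 2) :
    Tendsto (fun z => Ψ z i 0 - Ψ z i 1) (Bornology.cobounded ℂ) (𝓝 (sgn i)) := by
  convert (h.tendsto_cobounded i 0).sub (h.tendsto_cobounded i 1) using 2
  fin_cases i <;> simp [sgn, Matrix.one_apply]

theorem add_eq_root (h : IsSolution Ψ) (i : Fin 2) :
    ∀ z ∈ cutᶜ, Ψ z i 0 + Ψ z i 1 = root z := by
  set S : ℂ → ℂ := fun z => Ψ z i 0 + Ψ z i 1 with hS
  obtain ⟨H, hH, hSH⟩ := exists_entire_eqOn (f := fun z => S z * (root z)⁻¹)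
    (((h.analytic i 0).add (h.analytic i 1)).mul
      (analyticOnNhd_root.inv fun z _ => root_ne_zero z)).differentiableOn
    (by
      intro t ht h0
      obtain ⟨s, d, hs1, hs2, -, -⟩ := (h.hasJumpAt ht h0).row i
      obtain ⟨r, hr, hr1, hr2⟩ := exists_tendsto_root ht h0
      -- The common boundary value: from above it appears as κs/(κr).
      refine ⟨s * r⁻¹, ?_, hs2.mul (hr2.inv₀ hr)⟩
      convert hs1.mul (hr1.inv₀ (mul_ne_zero (jumpFactor_ne_zero t) hr)) using 2
      have := jumpFactor_ne_zero t
      field_simp)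
    (by
      have := tendsto_sub_mul_of_isBigO (F := S) (G := fun z => (root z)⁻¹) zero_mem_cut
        (a := -(1 / 2)) (b := 1 / 2) (by norm_num)
        (by simpa only [sub_zero] using (h.growth_zero i 0).add (h.growth_zero i 1))
        (by simpa only [sub_zero] using root_inv_isBigO_zero)
      simpa only [sub_zero] using this)
    (tendsto_sub_mul_of_isBigO (F := S) (G := fun z => (root z)⁻¹) one_mem_cut
        (a := -(1 / 4)) (b := -(1 / 4)) (by norm_num)
        ((h.growth_one i 0).add (h.growth_one i 1)) root_inv_isBigO_one)
    (by
      have := tendsto_sub_mul_of_isBigO (F := S) (G := fun z => (root z)⁻¹) neg_one_mem_cut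
        (a := -(1 / 4)) (b := -(1 / 4)) (by norm_num)
        (by simpa only [sub_neg_eq_add] using (h.growth_neg_one i 0).add (h.growth_neg_one i 1))
        (by simpa only [sub_neg_eq_add] using root_inv_isBigO_neg_one)
      simpa only [sub_neg_eq_add] using this)
  have hlim : Tendsto H (Bornology.cobounded ℂ) (𝓝 1) := by
    have := (h.tendsto_add_cobounded i).mul (tendsto_root_cobounded.inv₀ one_ne_zero)
    rw [inv_one, mul_one] at this
    exact this.congr' (hSH.eventuallyEq_of_mem compl_cut_mem_cobounded)
  intro z hz
  have e : S z * (root z)⁻¹ = 1 := (hSH hz).trans (eq_of_tendsto_cobounded hH hlim z)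
  have := root_ne_zero z
  field_simp at e
  exact e

theorem exists_sub_eq (h : IsSolution Ψ) (i : Fin 2) :
    ∃ ξ : ℂ, ∀ z ∈ cutᶜ, Ψ z i 0 - Ψ z i 1 = (sgn i + 2 * ξ / z) * (root z)⁻¹ := by
  set D : ℂ → ℂ := fun z => Ψ z i 0 - Ψ z i 1 with hD
  have hz1 : ∀ p : ℂ, (fun z : ℂ => z) =O[𝓝[cutᶜ] p] fun _ => (1 : ℝ) := fun p =>
    Tendsto.isBigO_one ℝ (tendsto_id.mono_left nhdsWithin_le_nhds)
  -- The product of the difference with `root` may have a simple pole at 0; the extra factor z makes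
  -- that singularity removable.
  have hD0 : (fun z => z * D z) =O[𝓝[cutᶜ] 0] fun z => ‖z‖ ^ (1 / 2 : ℝ) := by
    refine ((isBigO_refl (fun z : ℂ => z) _).norm_right.mul
      ((h.growth_zero i 0).sub (h.growth_zero i 1))).congr' EventuallyEq.rfl
      (eventually_mem_nhdsWithin.mono fun z hz => ?_)
    have hz' : 0 < ‖z‖ := norm_pos_iff.2 (ne_zero_of_mem_compl_cut hz)
    dsimp only
    rw [← Real.rpow_one_add' hz'.le (by norm_num)]
    norm_num
  have hD1 : (fun z => z * D z) =O[𝓝[cutᶜ] 1] fun z => ‖z - 1‖ ^ (-(1 / 4) : ℝ) := by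
    simpa only [one_mul] using (hz1 1).mul ((h.growth_one i 0).sub (h.growth_one i 1))
  have hD2 : (fun z => z * D z) =O[𝓝[cutᶜ] (-1)] fun z => ‖z + 1‖ ^ (-(1 / 4) : ℝ) := by
    simpa only [one_mul] using (hz1 (-1)).mul ((h.growth_neg_one i 0).sub (h.growth_neg_one i 1))
  obtain ⟨H, hH, hDH⟩ := exists_entire_eqOn (f := fun z => z * D z * root z)
    ((analyticOnNhd_id.mul ((h.analytic i 0).sub (h.analytic i 1))).mul
      analyticOnNhd_root).differentiableOn
    (by
      intro t ht h0
      obtain ⟨s, d, -, -, hd1, hd2⟩ := (h.hasJumpAt ht h0).row i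
      obtain ⟨r, hr, hr1, hr2⟩ := exists_tendsto_root ht h0
      have hid : ∀ S : Set ℂ, Tendsto (fun z : ℂ => z) (𝓝[S] (t : ℂ)) (𝓝 (t : ℂ)) := fun S =>
        tendsto_id.mono_left nhdsWithin_le_nhds
      refine ⟨t * d * r, ?_, ((hid _).mul hd2).mul hr2⟩
      convert ((hid _).mul hd1).mul hr1 using 2
      -- The jumps -κ and κ multiply to -κ² = 1.
      linear_combination (t * d * r) * jumpFactor_mul_self t)
    (by
      have := tendsto_sub_mul_of_isBigO (F := fun z => z * D z) (G := root) zero_mem_cut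
        (a := 1 / 2) (b := -(1 / 2)) (by norm_num) (by simpa only [sub_zero] using hD0)
        (by simpa only [sub_zero] using root_isBigO_zero)
      simpa only [sub_zero] using this)
    (tendsto_sub_mul_of_isBigO (F := fun z => z * D z) (G := root) one_mem_cut
        (a := -(1 / 4)) (b := 1 / 4) (by norm_num) hD1 root_isBigO_one)
    (by
      have := tendsto_sub_mul_of_isBigO (F := fun z => z * D z) (G := root) neg_one_mem_cut
        (a := -(1 / 4)) (b := 1 / 4) (by norm_num)
        (by simpa only [sub_neg_eq_add] using hD2)
        (by simpa only [sub_neg_eq_add] using root_isBigO_neg_one)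
      simpa only [sub_neg_eq_add] using this)
  -- `H 0` is the residue at 0 of `D * root`; K is what remains after removing the polar part.
  obtain ⟨K, hK, hHK⟩ := exists_entire_factor (G := fun z => H z - H 0) (hH.sub_const _) (p := 0)
    (sub_self _)
  have hKD : ∀ z ∈ cutᶜ, D z * root z - H 0 * z⁻¹ = K z := by
    intro z hz
    have hz0 := ne_zero_of_mem_compl_cut hz
    have e := hHK z
    rw [← hDH hz, sub_zero] at e
    refine mul_left_cancel₀ hz0 ?_
    rw [← e]
    field_simp
  have hlim : Tendsto K (Bornology.cobounded ℂ) (𝓝 (sgn i)) := by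
    have := ((h.tendsto_sub_cobounded i).mul tendsto_root_cobounded).sub
      ((tendsto_inv₀_cobounded (α := ℂ)).const_mul (H 0))
    rw [mul_one, mul_zero, sub_zero] at this
    exact this.congr' (eventually_of_mem compl_cut_mem_cobounded hKD)
  -- Halved because the row (ξ, -ξ) contributes 2ξ to the difference of entries.
  refine ⟨H 0 / 2, fun z hz => ?_⟩
  have e := hKD z hz
  rw [eq_of_tendsto_cobounded hK hlim z] at e
  have := root_ne_zero z
  rw [eq_mul_inv_iff_mul_eq₀ this]
  linear_combination e

end IsSolution

/-! ### The explicit formula solves the problem -/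

/-- The explicit solution, entrywise. -/
theorem isSolution_of_eqOn {Ψ : ℂ → Matrix (Fin 2) (Fin 2) ℂ} {ξ : Fin 2 → ℂ}
    (hΨ : ∀ i j, ∀ z ∈ cutᶜ, Ψ z i j =
      (root z + sgn j * ((sgn i + 2 * ξ i / z) * (root z)⁻¹)) / 2) : IsSolution Ψ := by
  have hev : ∀ i j (p : ℂ), (fun z => (root z + sgn j * ((sgn i + 2 * ξ i / z) * (root z)⁻¹)) / 2)
      =ᶠ[𝓝[cutᶜ] p] fun z => Ψ z i j := fun i j p =>
    eventually_mem_nhdsWithin.mono fun z hz => (hΨ i j z hz).symm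
  have hbig : ∀ i j (p : ℂ) (g : ℂ → ℝ), root =O[𝓝[cutᶜ] p] g →
      (fun z => (sgn i + 2 * ξ i / z) * (root z)⁻¹) =O[𝓝[cutᶜ] p] g →
      (fun z => Ψ z i j) =O[𝓝[cutᶜ] p] g := by
    intro i j p g h1 h2
    refine IsBigO.congr' ?_ (hev i j p) EventuallyEq.rfl
    simp only [div_eq_inv_mul _ (2 : ℂ)]
    exact (h1.add (h2.const_mul_left _)).const_mul_left _
  have hcoef : ∀ i (p : ℂ), p ≠ 0 →
      (fun z => sgn i + 2 * ξ i / z) =O[𝓝[cutᶜ] p] fun _ => (1 : ℝ) := by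
    intro i p hp
    have : ContinuousAt (fun z => sgn i + 2 * ξ i / z) p := by fun_prop (disch := assumption)
    exact (this.tendsto.mono_left nhdsWithin_le_nhds).isBigO_one ℝ
  -- One germ F in the coordinate 1/z serves both analyticity at infinity and, through its value at
  -- 0, the normalization.
  have hinf : ∀ i j, ∃ F : ℂ → ℂ, AnalyticAt ℂ F 0 ∧ F 0 = (1 : Matrix (Fin 2) (Fin 2) ℂ) i j ∧
      ∀ᶠ z in Bornology.cobounded ℂ, Ψ z i j = F z⁻¹ := by
    intro i j
    refine ⟨fun w => (Complex.exp (Complex.log (1 - w ^ 2) / 4) + sgn j * ((sgn i + 2 * ξ i * w) *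
      (Complex.exp (Complex.log (1 - w ^ 2) / 4))⁻¹)) / 2, ?_, ?_, ?_⟩
    · exact (analyticAt_root_infty.add (analyticAt_const.mul ((analyticAt_const.add
        (analyticAt_const.mul analyticAt_id)).mul
        (analyticAt_root_infty.inv (Complex.exp_ne_zero _))))).div analyticAt_const two_ne_zero
    · fin_cases i <;> fin_cases j <;> simp [sgn]
    · filter_upwards [compl_cut_mem_cobounded] with z hz
      have e := root_inv_eq (inv_ne_zero (ne_zero_of_mem_compl_cut hz))
      rw [inv_inv] at e
      rw [hΨ i j z hz, ← e, div_eq_mul_inv (2 * ξ i)]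
  have hjump : ∀ t ∈ Set.Ioo (-1 : ℝ) 1, t ≠ 0 → HasJumpAt Ψ t (jumpFactor t • σ₁) := by
    intro t ht h0
    obtain ⟨r, hr, hr1, hr2⟩ := exists_tendsto_root ht h0
    have hκ := jumpFactor_ne_zero t
    have hlim : ∀ (S : Set ℂ) (q : ℂ), S ⊆ cutᶜ → q ≠ 0 → Tendsto root (𝓝[S] (t : ℂ)) (𝓝 q) →
        Tendsto Ψ (𝓝[S] (t : ℂ)) (𝓝 (Matrix.of fun i j =>
          (q + sgn j * ((sgn i + 2 * ξ i / t) * q⁻¹)) / 2)) := by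
      intro S q hS hq hroot
      refine tendsto_pi_nhds.2 fun i => tendsto_pi_nhds.2 fun j => ?_
      have hid : Tendsto (fun z : ℂ => z) (𝓝[S] (t : ℂ)) (𝓝 (t : ℂ)) :=
        tendsto_id.mono_left nhdsWithin_le_nhds
      refine Tendsto.congr' ((hev i j t).filter_mono (nhdsWithin_mono _ hS)) ?_
      exact (hroot.add (((tendsto_const_nhds.add (tendsto_const_nhds.div hid (by simpa))).mul
        (hroot.inv₀ hq)).const_mul _)).div_const _
    refine ⟨_, _, hlim _ _ upper_subset (mul_ne_zero hκ hr) hr1, hlim _ _ lower_subset hr hr2, ?_⟩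
    -- Since κ² = -1, inverting the root changes its jump factor to -κ.
    have e : (jumpFactor t * r)⁻¹ = -(jumpFactor t * r⁻¹) := by
      refine inv_eq_of_mul_eq_one_right ?_
      have := mul_inv_cancel₀ hr
      linear_combination (-r * r⁻¹) * jumpFactor_mul_self t + this
    ext i j
    rw [e]
    fin_cases j <;> simp [Matrix.mul_apply, Fin.sum_univ_two, σ₁, sgn] <;> ring
  refine ⟨fun i j => ?_, fun i j => ?_, fun t ht => ?_, fun t ht => ?_, fun i j => ?_,
    fun i j => ?_, fun i j => ?_, fun i j => ?_⟩
  · refine AnalyticOnNhd.congr isClosed_cut.isOpen_compl ?_ fun z hz => (hΨ i j z hz).symm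
    intro z hz
    have hr := analyticOnNhd_root z hz
    exact (hr.add (analyticAt_const.mul ((analyticAt_const.add (analyticAt_const.div analyticAt_id
      (ne_zero_of_mem_compl_cut hz))).mul (hr.inv (root_ne_zero z))))).div analyticAt_const
      two_ne_zero
  · obtain ⟨F, hF, -, he⟩ := hinf i j
    refine ⟨F, hF, ?_⟩
    filter_upwards [tendsto_inv₀_nhdsNE_zero.eventually he] with w hw
    rw [hw, inv_inv]
  · have := hjump t ⟨ht.1, ht.2.trans one_pos⟩ ht.2.ne
    rwa [jumpFactor, if_neg ht.2.not_gt] at this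
  · have := hjump t ⟨by linarith [ht.1], ht.2⟩ ht.1.ne'
    rwa [jumpFactor, if_pos ht.1] at this
  · refine hbig i j _ _ (root_isBigO_one.trans (isBigO_rpow_norm_sub one_mem_cut (by norm_num))) ?_
    simpa only [one_mul] using (hcoef i 1 one_ne_zero).mul root_inv_isBigO_one
  · refine hbig i j _ _ (root_isBigO_neg_one.trans ?_) ?_
    · simpa only [sub_neg_eq_add] using
        isBigO_rpow_norm_sub neg_one_mem_cut (a := -(1 / 4)) (b := 1 / 4) (by norm_num)
    · simpa only [one_mul] using
        (hcoef i (-1) (neg_ne_zero.2 one_ne_zero)).mul root_inv_isBigO_neg_one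
  · refine hbig i j _ _ root_isBigO_zero ?_
    -- The pole costs a power -1 and 1/ρ gains 1/2, which leaves the permitted -1/2.
    have h1 : (fun z => sgn i + 2 * ξ i / z) =O[𝓝[cutᶜ] (0 : ℂ)] fun z => ‖z‖ ^ (-1 : ℝ) := by
      have h2 : (fun _ : ℂ => sgn i) =O[𝓝[cutᶜ] (0 : ℂ)] fun z => ‖z‖ ^ (-1 : ℝ) := by
        refine (isBigO_const_const (sgn i) (one_ne_zero (α := ℝ)) _).trans ?_
        simpa using isBigO_rpow_norm_sub zero_mem_cut (a := -1) (b := 0) (by norm_num)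
      refine h2.add ?_
      simp only [Real.rpow_neg_one, ← norm_inv]
      exact (isBigO_refl _ _).norm_right.const_mul_left _
    refine (h1.mul root_inv_isBigO_zero).congr' EventuallyEq.rfl
      (eventually_mem_nhdsWithin.mono fun z hz => ?_)
    dsimp only
    rw [← Real.rpow_add (norm_pos_iff.2 (ne_zero_of_mem_compl_cut hz))]
    norm_num
  · obtain ⟨F, hF, hF0, he⟩ := hinf i j
    have h1 := hF.differentiableAt.isBigO_sub.comp_tendsto (tendsto_inv₀_cobounded (α := ℂ))
    refine h1.congr' (he.mono fun z hz => ?_) (Eventually.of_forall fun z => ?_)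
    · simp [hz, hF0]
    · simp

end ModelRHP

end

theorem mainTheorem12 (Ψ : ℂ → Matrix (Fin 2) (Fin 2) ℂ) :
    ModelRHP.IsSolution Ψ ↔
      ∃ x y : ℂ, ∀ z ∈ ModelRHP.cutᶜ,
        Ψ z = (1 + (1 / z) • !![x, -x; y, -y]) *
          ModelRHP.matPow ((z ^ 2 - 1) / z ^ 2) ((1 / 4 : ℂ) • ModelRHP.σ₁) := by
  constructor
  · intro h
    choose ξ hξ using h.exists_sub_eq
    exact ⟨ξ 0, ξ 1, fun z hz => (ModelRHP.eq_formula_iff (Ψ z) ξ z).2 fun i =>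
      ⟨h.add_eq_root i z hz, hξ i z hz⟩⟩
  · rintro ⟨x, y, h⟩
    refine ModelRHP.isSolution_of_eqOn (ξ := ![x, y]) fun i j z hz => ?_
    obtain ⟨h1, h2⟩ := (ModelRHP.eq_formula_iff (Ψ z) ![x, y] z).1 (h z hz) i
    fin_cases j
    · simp only [ModelRHP.sgn, Fin.zero_eta, Matrix.cons_val_zero] at h2 ⊢
      linear_combination (h1 + h2) / 2
    · simp only [ModelRHP.sgn, Fin.mk_one, Matrix.cons_val_one, Matrix.cons_val_zero] at h2 ⊢
      linear_combination (h1 - h2) / 2
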